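/- Let $R$ be an artin algebra (a ring that is finitely generated as a module over some commutative artinian ring over which it is an algebra), let $\mathrm{mod}\,R$ be the category of finitely generated left $R$-modules, and let $\mathcal D^b(\mathrm{mod}\,R)$ be its bounded derived category. For $T\in\mathcal D^b(\mathrm{mod}\,R)$ let $\mathrm{add}\,T$ be the class of direct summands of finite direct sums of copies of $T$, and let ${}^{\perp_{k>0}}T$ be the class of objects $X$ with $\mathrm{Hom}(X,T[k])=0$ for all $k>0$. Call $T$ *semi-selforthogonal* if $\mathrm{Hom}(T,T[k])=0$ for all $k>0$. For a finite interval $I$ of integers let $\mathcal D^I(\mathrm{mod}\,R)$ be the class of objects whose cohomology is concentrated in degrees in $I$, and let $\mathcal X_T^I$ be the class of objects $X$ for which there are distinguished triangles $$X_i\to T_i\to X_{i+1}\to X_i[1]\qquad(i\ge 0)$$ with $X_0=X$, all $T_i\in\mathrm{add}\,T$ and all $X_i\in{}^{\perp_{k>0}}T\cap\mathcal D^I(\mathrm{mod}\,R)$. Let $\mathcal X_T^\flat$ be the union of the classes $\mathcal X_T^I$ over all finite intervals $I$ with $T\in\mathcal D^I(\mathrm{mod}\,R)$, and let $\langle\mathcal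 X_T^\flat\rangle_+$ be the class of all objects isomorphic to $C[n]$ with $C\in\mathcal X_T^\flat$ and $n\ge 0$. The complex $T$ is *Wakamatsu-silting* if it is semi-selforthogonal and $R$, viewed as a complex concentrated in degree $0$, lies in $\langle\mathcal X_T^\flat\rangle_+$. **Corollary.** Let $R$ and $S$ be artin algebras and let $F:\mathcal D^b(\mathrm{mod}\,R)\to\mathcal D^b(\mathrm{mod}\,S)$ be a triangle functor that is an equivalence of categories. Then for every $T\in\mathcal D^b(\mathrm{mod}\,R)$, $T$ is Wakamatsu-silting if and only if $F(T)$ is Wakamatsu-silting. -/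

import Mathlib

open CategoryTheory Limits Pretriangulated

universe w w' v u

/-- `R` is an artin algebra: it is an algebra over some commutative artinian ring `k` and is
finitely generated as a `k`-module. (Replacing `k` by its image in the centre of `R`, one may
always take `k` in the universe of `R`.) -/
class IsArtinAlgebra (R : Type u) [Ring R] : Prop where
  exists_base : ∃ (k : Type u) (_ : CommRing k) (_ : Algebra k R),
    IsArtinianRing k ∧ Module.Finite k R

/-- An artin algebra is (left) noetherian, so that its finitely generated left modules form an
abelian category. -/
instance IsArtinAlgebra.isNoetherianRing (R : Type u) [Ring R] [IsArtinAlgebra R] :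
    IsNoetherianRing R := by
  obtain ⟨k, _, _, _, _⟩ := IsArtinAlgebra.exists_base (R := R)
  have : IsNoetherian k R := inferInstance
  exact isNoetherian_of_tower k this

namespace WakamatsuSilting

noncomputable section

section Triangulated

variable {D : Type u} [Category.{v} D] [Preadditive D] [HasZeroObject D] [HasShift D ℤ]
  [∀ n : ℤ, (shiftFunctor D n).Additive] [Pretriangulated D]

/-- `add M`: the direct summands of finite direct sums of copies of `M`. -/
def addClosure (M : D) : ObjectProperty D := fun N =>
  ∃ (n : ℕ) (N' : D), Nonempty (N ⊞ N' ≅ ⨁ fun _ : Fin n => M)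

/-- `^{⊥_{k>0}} M`: the objects `X` with `Hom(X, M[k]) = 0` for all `k > 0`. -/
def leftPerpPos (M : D) : ObjectProperty D := fun X =>
  ∀ k : ℤ, 0 < k → ∀ f : X ⟶ M⟦k⟧, f = 0

/-- `M` is semi-selforthogonal: `Hom(M, M[k]) = 0` for all `k > 0`. -/
def IsSemiSelforthogonal (M : D) : Prop :=
  ∀ k : ℤ, 0 < k → ∀ f : M ⟶ M⟦k⟧, f = 0

/-- `⟨𝒞⟩₊`: the objects isomorphic to `C[n]` for some `C` in `𝒞` and some integer `n ≥ 0`. -/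
def nonnegShifts (P : ObjectProperty D) : ObjectProperty D := fun X =>
  ∃ (C : D) (n : ℤ), P C ∧ 0 ≤ n ∧ Nonempty (X ≅ C⟦n⟧)

end Triangulated

section Derived

variable {A : Type u} [Category.{v} A] [Abelian A] [HasDerivedCategory.{w} A]

/-- `D^{[a,b]}(A)`: the objects of `D^b(A)` whose cohomology is concentrated in `[a, b]`. -/
def homologyIn (a b : ℤ) : ObjectProperty (DerivedCategory.Bounded A) := fun X =>
  ∀ i : ℤ, i ∉ Set.Icc a b → IsZero ((DerivedCategory.homologyFunctor A i).obj X.obj)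

/-- `𝒳_M^{[a,b]}`: the objects `X` in `^{⊥_{k>0}} M` for which there are distinguished triangles
`X_i ⟶ M_i ⟶ X_{i+1} ⟶ X_i[1]` for `i ≥ 0`, with `X_0 = X`, every `M_i` in `add M` and every
`X_i` in `^{⊥_{k>0}} M ∩ D^{[a,b]}(A)`. -/
def coAuslanderIn (M : DerivedCategory.Bounded A) (a b : ℤ) :
    ObjectProperty (DerivedCategory.Bounded A) := fun X =>
  leftPerpPos M X ∧
  ∃ (Y N : ℕ → DerivedCategory.Bounded A),
    Nonempty (Y 0 ≅ X) ∧
    (∀ i, addClosure M (N i)) ∧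
    (∀ i, leftPerpPos M (Y i) ∧ homologyIn a b (Y i)) ∧
    ∀ i, ∃ (f : Y i ⟶ N i) (g : N i ⟶ Y (i + 1)) (h : Y (i + 1) ⟶ (Y i)⟦(1 : ℤ)⟧),
      Triangle.mk f g h ∈ distTriang (DerivedCategory.Bounded A)

/-- The co-Auslander class `𝒳_M^♭`: the union of the classes `𝒳_M^{[a,b]}` over all finite
intervals `[a, b]` such that `M` lies in `D^{[a,b]}(A)`. -/
def coAuslander (M : DerivedCategory.Bounded A) :
    ObjectProperty (DerivedCategory.Bounded A) := fun X =>
  ∃ a b : ℤ, homologyIn a b M ∧ coAuslanderIn M a b X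

end Derived

section Algebra

variable (R : Type u) [Ring R] [IsArtinAlgebra R] [HasDerivedCategory.{w} (FGModuleCat.{u} R)]

/-- `D^b(mod R)`, the bounded derived category of finitely generated left `R`-modules. -/
abbrev Db := DerivedCategory.Bounded (FGModuleCat.{u} R)

/-- The regular module `R` as a stalk complex in degree `0`, an object of `D^b(mod R)`. -/
def regular : Db R :=
  ⟨(DerivedCategory.singleFunctor (FGModuleCat.{u} R) 0).obj (FGModuleCat.of R R),
    ⟨0, inferInstance⟩, ⟨0, inferInstance⟩⟩

variable {R}

/-- `T ∈ D^b(mod R)` is Wakamatsu-silting if it is semi-selforthogonal and `R ∈ ⟨𝒳_T^♭⟩₊`. -/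
def IsWakamatsuSilting (T : Db R) : Prop :=
  IsSemiSelforthogonal T ∧ nonnegShifts (coAuslander T) (regular R)

end Algebra

end

end WakamatsuSilting

/-! A full triangle functor `F` carries semi-selforthogonality, `add T`, the perpendicular class and
the defining triangles to those of `F(T)`. Two points need an argument.

Boundedness: the coresolutions must stay in one finite interval. Every object with cohomology in
`[a, b]` is a finite extension of shifted stalk modules, and every module a finite extension of
simples, which are retracts of `R/J` (`J` the Jacobson radical). So the cohomological range of
`F(R/J)` bounds `F` on each interval (`exists_homologyIn_le_inverseImage`), and `F` maps `⟨𝒳_T^♭⟩₊`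
into `⟨𝒳_{F(T)}^♭⟩₊`.

The regular module: `F(R)` need not be `S`. But `⟨𝒳_{F(T)}^♭⟩₊` is thick: extensions come from a
horseshoe lemma, negative shifts from the triangles `X[-1] → 0 → X`, retracts from an octahedron.
Its preimage under `F` is a thick class containing `R`. An `X` with `F(X) ≅ S` has `Hom(X, M[i]) =
0` for all large `i`, uniformly in the module `M`, hence finite projective dimension, hence lies in
every thick class containing `R` (`prop_of_homsZero`). So `S` lies in `⟨𝒳_{F(T)}^♭⟩₊`. The converse
applies this to the inverse equivalence. -/

namespace WakamatsuSilting

/-! ### Infinite coresolutions in a triangulated category. -/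

section Triangulated

variable {D : Type u} [Category.{v} D] [Preadditive D] [HasZeroObject D] [HasShift D ℤ]
  [∀ n : ℤ, (shiftFunctor D n).Additive] [Pretriangulated D]

/-- There are no nonzero morphisms from `X` to `Y`. -/
def HomsZero {C : Type u} [Category.{v} C] [HasZeroMorphisms C] (X Y : C) : Prop :=
  ∀ f : X ⟶ Y, f = 0

lemma HomsZero.of_iso {C : Type u} [Category.{v} C] [HasZeroMorphisms C] {X Y X' Y' : C}
    (h : HomsZero X Y) (e : X ≅ X') (e' : Y ≅ Y') : HomsZero X' Y' := fun f => by
  rw [← cancel_epi e.hom, ← cancel_mono e'.inv, comp_zero, zero_comp]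
  exact h _

lemma HomsZero.of_retract {C : Type u} [Category.{v} C] [HasZeroMorphisms C] {X Y X' Y' : C}
    (h : HomsZero X Y) (e : Retract X' X) (e' : Retract Y' Y) : HomsZero X' Y' := fun f => by
  have : f = e.i ≫ (e.r ≫ f ≫ e'.i) ≫ e'.r := by simp
  rw [this, h (e.r ≫ f ≫ e'.i), zero_comp, comp_zero]

lemma homsZero_shift_iff {C : Type u} [Category.{v} C] [Preadditive C] [HasShift C ℤ]
    [∀ n : ℤ, (shiftFunctor C n).Additive] (n : ℤ) (X Y : C) :
    HomsZero (X⟦n⟧) (Y⟦n⟧) ↔ HomsZero X Y := by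
  refine ⟨fun h f => (shiftFunctor C n).map_injective ?_, fun h f => ?_⟩
  · rw [Functor.map_zero]
    exact h _
  · obtain ⟨g, rfl⟩ := (shiftFunctor C n).map_surjective f
    rw [h g, Functor.map_zero]

/-- There is a distinguished triangle `X ⟶ Y ⟶ Z ⟶ X⟦1⟧`. -/
def IsTri (X Y Z : D) : Prop :=
  ∃ (f : X ⟶ Y) (g : Y ⟶ Z) (h : Z ⟶ X⟦(1 : ℤ)⟧), Triangle.mk f g h ∈ distTriang D

lemma HomsZero.of_isTri_target {X Y Z W : D} (H : IsTri X Y Z) (hX : HomsZero W X)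
    (hZ : HomsZero W Z) : HomsZero W Y := fun φ => by
  obtain ⟨f, g, h, H⟩ := H
  obtain ⟨ψ, rfl⟩ : ∃ ψ : W ⟶ X, φ = ψ ≫ f := Triangle.coyoneda_exact₂ _ H φ (hZ _)
  rw [hX ψ, zero_comp]

lemma HomsZero.of_isTri_source {X Y Z W : D} (H : IsTri X Y Z) (hX : HomsZero X W)
    (hZ : HomsZero Z W) : HomsZero Y W := fun φ => by
  obtain ⟨f, g, h, H⟩ := H
  obtain ⟨ψ, rfl⟩ : ∃ ψ : Z ⟶ W, φ = g ≫ ψ := Triangle.yoneda_exact₂ _ H φ (hX _)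
  rw [hZ ψ, comp_zero]

lemma IsTri.of_iso {X Y Z X' Y' Z' : D} (H : IsTri X Y Z) (e₁ : X ≅ X') (e₂ : Y ≅ Y')
    (e₃ : Z ≅ Z') : IsTri X' Y' Z' := by
  obtain ⟨f, g, h, H⟩ := H
  refine ⟨e₁.inv ≫ f ≫ e₂.hom, e₂.inv ≫ g ≫ e₃.hom, e₃.inv ≫ h ≫ e₁.hom⟦1⟧',
    isomorphic_distinguished _ H _ (Triangle.isoMk _ _ e₁.symm e₂.symm e₃.symm ?_ ?_ ?_)⟩
  · change (e₁.inv ≫ f ≫ e₂.hom) ≫ e₂.inv = e₁.inv ≫ f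
    simp
  · change (e₂.inv ≫ g ≫ e₃.hom) ≫ e₃.inv = e₂.inv ≫ g
    simp
  · change (e₃.inv ≫ h ≫ e₁.hom⟦1⟧') ≫ e₁.inv⟦1⟧' = e₃.inv ≫ h
    simp [← Functor.map_comp]

lemma exists_iso_of_distTriang {X Y Z Z' : D} {f : X ⟶ Y} {g : Y ⟶ Z} {h : Z ⟶ X⟦(1 : ℤ)⟧}
    (H : Triangle.mk f g h ∈ distTriang D) {g' : Y ⟶ Z'} {h' : Z' ⟶ X⟦(1 : ℤ)⟧}
    (H' : Triangle.mk f g' h' ∈ distTriang D) : Nonempty (Z ≅ Z') :=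
  ⟨Triangle.π₃.mapIso
    (isoTriangleOfIso₁₂ _ _ H H' (Iso.refl _) (Iso.refl _)
      (show f ≫ 𝟙 Y = 𝟙 X ≫ f by simp))⟩

lemma IsTri.prop₂ (P : ObjectProperty D) [P.IsTriangulatedClosed₂] [P.IsClosedUnderIsomorphisms]
    {X Y Z : D} (H : IsTri X Y Z) (hX : P X) (hZ : P Z) : P Y := by
  obtain ⟨f, g, h, H⟩ := H
  exact P.ext_of_isTriangulatedClosed₂ _ H hX hZ

/-- The objects `X` admitting triangles `Y i ⟶ N i ⟶ Y (i + 1) ⟶ (Y i)⟦1⟧` with `Y 0 ≅ X`, all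
`N i` in `A` and all `Y i` in `Q`. -/
def HasCoresolution (A Q : ObjectProperty D) : ObjectProperty D := fun X =>
  ∃ Y N : ℕ → D, Nonempty (Y 0 ≅ X) ∧ (∀ i, A (N i)) ∧ (∀ i, Q (Y i)) ∧
    ∀ i, IsTri (Y i) (N i) (Y (i + 1))

namespace HasCoresolution

variable {A Q : ObjectProperty D}

instance : (HasCoresolution A Q).IsClosedUnderIsomorphisms where
  of_iso := by
    rintro X X' e ⟨Y, N, ⟨e'⟩, h⟩
    exact ⟨Y, N, ⟨e' ≪≫ e⟩, h⟩

lemma prop [Q.IsClosedUnderIsomorphisms] {X : D} (h : HasCoresolution A Q X) : Q X := by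
  obtain ⟨Y, N, ⟨e⟩, _, hY, _⟩ := h
  exact Q.prop_of_iso e (hY 0)

lemma step {X : D} (h : HasCoresolution A Q X) :
    ∃ N X' : D, A N ∧ HasCoresolution A Q X' ∧ IsTri X N X' := by
  obtain ⟨Y, N, ⟨e⟩, hN, hY, hT⟩ := h
  exact ⟨N 0, Y 1, hN 0, ⟨fun i => Y (i + 1), fun i => N (i + 1), ⟨Iso.refl _⟩, fun i => hN _,
    fun i => hY _, fun i => hT _⟩, (hT 0).of_iso e (Iso.refl _) (Iso.refl _)⟩

/-- Coinduction: `HasCoresolution A Q` is the largest class of objects of `Q` all of which embed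
in an object of `A` with cone in the class. -/
lemma coind {C : ObjectProperty D} (hQ : C ≤ Q)
    (hC : ∀ X, C X → ∃ N X' : D, A N ∧ C X' ∧ IsTri X N X') : C ≤ HasCoresolution A Q := by
  choose N X' hN hX' hT using hC
  intro X hX
  let s : ℕ → {X // C X} := fun n => Nat.rec ⟨X, hX⟩ (fun _ Z => ⟨X' Z.1 Z.2, hX' _ _⟩) n
  exact ⟨fun i => (s i).1, fun i => N _ (s i).2, ⟨Iso.refl _⟩, fun i => hN _ _,
    fun i => hQ _ (s i).2, fun i => hT _ _⟩

lemma mono {Q' : ObjectProperty D} (h : Q ≤ Q') : HasCoresolution A Q ≤ HasCoresolution A Q' := by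
  rintro X ⟨Y, N, e, hN, hY, hT⟩
  exact ⟨Y, N, e, hN, fun i => h _ (hY i), hT⟩

end HasCoresolution

/-- A form of the horseshoe lemma. -/
lemma horseshoe [IsTriangulated D] {X Y Z N M X' Z' : D} {i : X ⟶ Y} {p : Y ⟶ Z}
    {w : Z ⟶ X⟦(1 : ℤ)⟧} (hT : Triangle.mk i p w ∈ distTriang D)
    (hX : IsTri X N X') (hZ : IsTri Z M Z') (h0 : ∀ φ : Z ⟶ N⟦(1 : ℤ)⟧, φ = 0) :
    ∃ Y' : D, IsTri Y (N ⊞ M) Y' ∧ IsTri X' Y' Z' := by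
  obtain ⟨f, f', f'', hf⟩ := hX
  obtain ⟨g, g', g'', hg⟩ := hZ
  -- The obstruction to extending `f` along `i` is a map `Z[-1] → N`, zero by `h0`.
  obtain ⟨u, hu⟩ : ∃ u : Y ⟶ N, f = i ≫ u := by
    refine Triangle.yoneda_exact₂ _ (inv_rot_of_distTriang _ hT) f ?_
    exact (homsZero_shift_iff (-1) Z (N⟦(1 : ℤ)⟧)).2 h0 |>.of_iso (Iso.refl _)
      ((shiftEquiv D (1 : ℤ)).unitIso.symm.app N) _
  obtain ⟨F, a, b, hF⟩ := distinguished_cocone_triangle₁ (biprod.lift u p)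
  have hE : Triangle.mk (biprod.inl : N ⟶ N ⊞ Z) biprod.snd 0 ∈ distTriang D :=
    binaryBiproductTriangle_distinguished N Z
  -- The map `(u, p) : Y → N ⊞ Z` followed by the projection is `p`; comparing fibres gives `F → X →
  -- N` with second map `f`, so `F[1] ≅ X'`.
  let o := Triangulated.someOctahedron' (biprod.lift_snd u p) hF hE hT
  have hm : o.m₃ = f := by
    rw [← cancel_mono (biprod.inl : N ⟶ N ⊞ Z), o.comm₄]
    ext <;> simp [hu]
    exact comp_distTriang_mor_zero₁₂ _ hT
  have hF' := rot_of_distTriang _ hF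
  have ho := rot_of_distTriang _ o.mem
  rw [hm] at ho
  obtain ⟨eX⟩ := exists_iso_of_distTriang ho hf
  -- The cone of `𝟙 ⊞ g` is that of `g`, namely `Z'`. The embedding of `Y` is `(u, p)` followed by
  -- `𝟙 ⊞ g`, so its cone is an extension of `Z'` by `X'`.
  obtain ⟨V, c, d, hV⟩ := distinguished_cocone_triangle (biprod.map (𝟙 N) g)
  have hE' : Triangle.mk (biprod.inl : N ⟶ N ⊞ M) biprod.snd 0 ∈ distTriang D :=
    binaryBiproductTriangle_distinguished N M
  let o' := Triangulated.someOctahedron (show biprod.inl ≫ biprod.map (𝟙 N) g = biprod.inl by simp)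
    hE hV hE'
  have hm' : o'.m₁ = g := by
    rw [← cancel_epi (biprod.snd : N ⊞ Z ⟶ Z), o'.comm₁]
    simp
  have ho' := o'.mem
  rw [hm'] at ho'
  obtain ⟨eZ⟩ := exists_iso_of_distTriang ho' hg
  obtain ⟨Y', y, y', hY'⟩ := distinguished_cocone_triangle (biprod.lift u p ≫ biprod.map (𝟙 N) g)
  exact ⟨Y', ⟨_, _, _, hY'⟩,
    IsTri.of_iso ⟨_, _, _, (Triangulated.someOctahedron rfl hF' hV hY').mem⟩ eX (Iso.refl _) eZ⟩

/-- The cone of a split monomorphism is a retract of the target. -/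
lemma exists_cone_retract {X Y : D} (r : Retract Y X) :
    ∃ (Y' : D) (p : X ⟶ Y') (w : Y' ⟶ Y⟦(1 : ℤ)⟧), Triangle.mk r.i p w ∈ distTriang D ∧
      Nonempty (Retract Y' X) := by
  obtain ⟨Y', p, w, h⟩ := distinguished_cocone_triangle r.i
  refine ⟨Y', p, w, h, ?_⟩
  have hw : w = 0 := Triangle.mor₃_eq_zero_of_mono₁ _ h (inferInstanceAs (Mono r.i))
  obtain ⟨s, hs⟩ := Triangle.coyoneda_exact₃ _ h (𝟙 Y')
    (show 𝟙 Y' ≫ w = 0 by simp [hw])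
  exact ⟨⟨s, p, hs.symm⟩⟩

section

variable [IsTriangulated D] {A Q : ObjectProperty D}

/-- Coinduction on the class of extensions of two coresolved objects: the horseshoe lemma exhibits
the next cosyzygy as again such an extension. -/
lemma HasCoresolution.closed₂ [Q.IsClosedUnderIsomorphisms] [Q.IsTriangulatedClosed₂]
    (hA : ∀ M N, A M → A N → A (M ⊞ N))
    (h0 : ∀ Z N : D, Q Z → A N → ∀ φ : Z ⟶ N⟦(1 : ℤ)⟧, φ = 0) :
    (HasCoresolution A Q).IsTriangulatedClosed₂ := by
  refine .mk' fun T hT h₁ h₃ => HasCoresolution.coind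
    (C := fun Y => ∃ X Z, HasCoresolution A Q X ∧ HasCoresolution A Q Z ∧ IsTri X Y Z) ?_ ?_ _
    ⟨_, _, h₁, h₃, _, _, _, hT⟩
  · rintro Y ⟨X, Z, hX, hZ, h⟩
    exact h.prop₂ Q hX.prop hZ.prop
  · rintro Y ⟨X, Z, hX, hZ, ⟨i, p, w, h⟩⟩
    obtain ⟨N, X', hN, hX', hT⟩ := hX.step
    obtain ⟨M, Z', hM, hZ', hT'⟩ := hZ.step
    obtain ⟨Y', h₁, h₂⟩ := horseshoe h hT hT' (h0 _ _ hZ.prop hN)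
    exact ⟨_, Y', hA _ _ hN hM, ⟨X', Z', hX', hZ', h₂⟩, h₁⟩

/-- Coinduction on the class of retracts, using closure under extensions to handle the cosyzygies.
-/
lemma HasCoresolution.retracts [Q.IsTriangulatedClosed₂] [Q.IsStableUnderRetracts]
    (hA : ∀ M N, A M → A N → A (M ⊞ N))
    (h0 : ∀ Z N : D, Q Z → A N → ∀ φ : Z ⟶ N⟦(1 : ℤ)⟧, φ = 0) :
    (HasCoresolution A Q).IsStableUnderRetracts := by
  have := HasCoresolution.closed₂ hA h0
  refine ⟨fun {Y X} r hX => HasCoresolution.coind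
    (C := (HasCoresolution A Q).retractClosure) ?_ ?_ _ ⟨X, hX, ⟨r⟩⟩⟩
  · rintro Y ⟨X, hX, ⟨r⟩⟩
    exact Q.prop_of_retract r hX.prop
  · rintro Y ⟨X, hX, ⟨r⟩⟩
    obtain ⟨Y', p, w, hT, ⟨r'⟩⟩ := exists_cone_retract r
    obtain ⟨N, X', hN, hX', ⟨f, f', f'', hf⟩⟩ := hX.step
    -- Embed `Y` in `N` through `X`. By the octahedral axiom the cone `Y₁` is an extension of `X'`
    -- by the complement of `Y` in `X`, so it is a retract of an extension of coresolved objects.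
    obtain ⟨Y₁, g, h, hY₁⟩ := distinguished_cocone_triangle (r.i ≫ f)
    refine ⟨N, Y₁, hN, ?_, ⟨_, _, _, hY₁⟩⟩
    refine (ObjectProperty.monotone_retractClosure
      (ObjectProperty.extensionProduct_le_of_isTriangulatedClosed₂ le_rfl le_rfl)) _
      (ObjectProperty.extensionProduct_retractClosure_retractClosure_le
        (HasCoresolution A Q) (HasCoresolution A Q) _
        ⟨_, _, _, _, _, (Triangulated.someOctahedron rfl hT hf hY₁).mem, ⟨X, hX, ⟨r'⟩⟩,
          ObjectProperty.le_retractClosure _ _ hX'⟩)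

end

end Triangulated

end WakamatsuSilting

namespace WakamatsuSilting

/-! ### Closure properties of `add M` and of the perpendicular class. -/

section Triangulated

variable {D : Type u} [Category.{v} D] [Preadditive D] [HasZeroObject D] [HasShift D ℤ]
  [∀ n : ℤ, (shiftFunctor D n).Additive] [Pretriangulated D]

lemma IsTri.shift {X Y Z : D} (H : IsTri X Y Z) (n : ℤ) : IsTri (X⟦n⟧) (Y⟦n⟧) (Z⟦n⟧) := by
  obtain ⟨f, g, h, H⟩ := H
  exact ⟨_, _, _, Triangle.shift_distinguished _ H n⟩

lemma addClosure_iff {M N : D} :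
    addClosure M N ↔ ∃ n : ℕ, Nonempty (Retract N (⨁ fun _ : Fin n => M)) := by
  constructor
  · rintro ⟨n, N', ⟨e⟩⟩
    exact ⟨n, ⟨(⟨biprod.inl, biprod.fst, by simp⟩ : Retract N (N ⊞ N')).trans (.ofIso e)⟩⟩
  · rintro ⟨n, ⟨r⟩⟩
    obtain ⟨N', p, w, h, -⟩ := exists_cone_retract r
    obtain ⟨e, -⟩ := exists_iso_binaryBiproduct_of_distTriang _ h
      (Triangle.mor₃_eq_zero_of_mono₁ _ h (inferInstanceAs (Mono r.i)))
    exact ⟨n, N', ⟨e.symm⟩⟩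

lemma addClosure_biprod {M N N' : D} (h : addClosure M N) (h' : addClosure M N') :
    addClosure M (N ⊞ N') := by
  rw [addClosure_iff] at h h' ⊢
  obtain ⟨n, ⟨r⟩⟩ := h
  obtain ⟨m, ⟨r'⟩⟩ := h'
  refine ⟨n + m, ⟨(⟨biprod.map r.i r'.i, biprod.map r.r r'.r, by ext <;> simp⟩ :
    Retract (N ⊞ N') ((⨁ fun _ : Fin n => M) ⊞ (⨁ fun _ : Fin m => M))).trans
    ⟨biprod.desc (biproduct.desc fun j => biproduct.ι (fun _ : Fin (n + m) => M) (Fin.castAdd m j))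
      (biproduct.desc fun j => biproduct.ι (fun _ : Fin (n + m) => M) (Fin.natAdd n j)),
     biprod.lift (biproduct.lift fun j => biproduct.π (fun _ : Fin (n + m) => M) (Fin.castAdd m j))
      (biproduct.lift fun j => biproduct.π (fun _ : Fin (n + m) => M) (Fin.natAdd n j)), ?_⟩⟩⟩
  ext i j <;> simp [biproduct.ι_π, Fin.ext_iff]
  all_goals intros; omega

lemma addClosure_of_isZero (M : D) {N : D} (h : IsZero N) : addClosure M N :=
  addClosure_iff.2 ⟨0, ⟨⟨0, 0, h.eq_of_src _ _⟩⟩⟩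

instance (M : D) : (leftPerpPos M).IsStableUnderRetracts where
  of_retract r h k hk := HomsZero.of_retract (h k hk) r (.refl _)

instance (M : D) : (leftPerpPos M).IsTriangulatedClosed₂ :=
  .mk' fun _ hT h₁ h₃ k hk => HomsZero.of_isTri_source ⟨_, _, _, hT⟩ (h₁ k hk) (h₃ k hk)

lemma leftPerpPos.shift {M X : D} (h : leftPerpPos M X) {n : ℤ} (hn : n ≤ 0) :
    leftPerpPos M (X⟦n⟧) := fun k hk =>
  ((homsZero_shift_iff n X (M⟦k - n⟧)).2 (h (k - n) (by omega))).of_iso (Iso.refl _)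
    ((shiftFunctorAdd' D (k - n) n k (by omega)).symm.app M)

lemma leftPerpPos_of_isZero (M : D) {X : D} (h : IsZero X) : leftPerpPos M X :=
  fun _ _ _ => h.eq_of_src _ _

lemma leftPerpPos.homsZero_addClosure {M Z N : D} (hZ : leftPerpPos M Z) (hN : addClosure M N)
    {k : ℤ} (hk : 0 < k) : HomsZero Z (N⟦k⟧) := by
  obtain ⟨n, ⟨r⟩⟩ := addClosure_iff.1 hN
  refine HomsZero.of_retract (Y := (⨁ fun _ : Fin n => M)⟦k⟧) (fun f => ?_) (.refl _)
    (r.map (shiftFunctor D k))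
  have h := congr_arg (fun g => f ≫ (shiftFunctor D k).map g)
    (biproduct.total (f := fun _ : Fin n => M))
  simp only [Functor.map_sum, Functor.map_comp, CategoryTheory.Functor.map_id,
    Category.comp_id, Preadditive.comp_sum] at h
  rw [← h]
  refine Finset.sum_eq_zero fun j _ => ?_
  rw [← Category.assoc, hZ k hk (f ≫ _), zero_comp]

end Triangulated

/-! ### Cohomology intervals and thickness of `⟨𝒳_T^♭⟩₊`. -/

section Derived

variable {A : Type u} [Category.{v} A] [Abelian A] [HasDerivedCategory.{w} A]

open DerivedCategory Triangulated ZeroObject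

/-- The canonical t-structure on the bounded derived category. -/
noncomputable abbrev tB (A : Type u) [Category.{v} A] [Abelian A] [HasDerivedCategory.{w} A] :
    TStructure (DerivedCategory.Bounded A) := TStructure.t.onBounded

lemma homologyIn_iff {a b : ℤ} {X : DerivedCategory.Bounded A} :
    homologyIn a b X ↔ (tB A).IsGE X a ∧ (tB A).IsLE X b := by
  rw [ObjectProperty.tStructure_isLE_iff, ObjectProperty.tStructure_isGE_iff]
  change _ ↔ X.obj.IsGE a ∧ X.obj.IsLE b
  rw [isGE_iff, isLE_iff]
  constructor
  · intro h
    exact ⟨fun i hi => h i (by simp; omega), fun i hi => h i (by simp; omega)⟩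
  · rintro ⟨h, h'⟩ i hi
    by_cases hi' : i < a
    · exact h i hi'
    · exact h' i (by simp at hi; omega)

lemma exists_homologyIn (X : DerivedCategory.Bounded A) : ∃ a b, homologyIn a b X := by
  obtain ⟨⟨a, ha⟩, ⟨b, hb⟩⟩ := X.property
  refine ⟨a, b, homologyIn_iff.2 ⟨?_, ?_⟩⟩
  · exact (ObjectProperty.tStructure_isGE_iff _ _ _ _).2 ha
  · exact (ObjectProperty.tStructure_isLE_iff _ _ _ _).2 hb

lemma homologyIn_mono {a b a' b' : ℤ} (h : a' ≤ a) (h' : b ≤ b') :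
    (homologyIn a b : ObjectProperty (DerivedCategory.Bounded A)) ≤ homologyIn a' b' :=
  fun _ hX i hi => hX i (by simp at hi ⊢; omega)

lemma homologyIn.shift {a b : ℤ} {X : DerivedCategory.Bounded A} (h : homologyIn a b X) (n : ℤ)
    {a' b' : ℤ} (ha : n + a' = a) (hb : n + b' = b) : homologyIn a' b' (X⟦n⟧) := by
  rw [homologyIn_iff] at h ⊢
  have := h.1
  have := h.2
  exact ⟨(tB A).isGE_shift X a n a' ha, (tB A).isLE_shift X b n b' hb⟩

lemma homologyIn_of_isZero (a b : ℤ) {X : DerivedCategory.Bounded A} (h : IsZero X) :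
    homologyIn a b X := fun i _ =>
  (DerivedCategory.Bounded.ι ⋙ homologyFunctor A i).map_isZero h

instance (a b : ℤ) : (homologyIn a b :
    ObjectProperty (DerivedCategory.Bounded A)).IsStableUnderRetracts where
  of_retract r h i hi := by
    have r' := r.map (DerivedCategory.Bounded.ι ⋙ homologyFunctor A i)
    exact (h i hi).of_mono r'.i

instance (a b : ℤ) : (homologyIn a b :
    ObjectProperty (DerivedCategory.Bounded A)).IsTriangulatedClosed₂ :=
  .mk' fun T hT h₁ h₃ => by
    rw [homologyIn_iff] at h₁ h₃ ⊢
    exact ⟨(tB A).isGE₂ T hT a h₁.1 h₃.1, (tB A).isLE₂ T hT b h₁.2 h₃.2⟩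

instance {D : Type u} [Category.{v} D] (P Q : ObjectProperty D) [P.IsStableUnderRetracts]
    [Q.IsStableUnderRetracts] : (P ⊓ Q).IsStableUnderRetracts where
  of_retract r h := ⟨P.prop_of_retract r h.1, Q.prop_of_retract r h.2⟩

variable {T : DerivedCategory.Bounded A}

/-- `𝒳_T^{[a,b]}` as a class of objects with coresolutions. -/
abbrev coAus (T : DerivedCategory.Bounded A) (a b : ℤ) :
    ObjectProperty (DerivedCategory.Bounded A) :=
  HasCoresolution (addClosure T) (leftPerpPos T ⊓ homologyIn a b)

lemma coAuslanderIn_iff {a b : ℤ} {X : DerivedCategory.Bounded A} :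
    coAuslanderIn T a b X ↔ coAus T a b X := by
  constructor
  · rintro ⟨-, h⟩
    exact h
  · intro h
    exact ⟨h.prop.1, h⟩

lemma coAus_mono {a b a' b' : ℤ} (h : a' ≤ a) (h' : b ≤ b') : coAus T a b ≤ coAus T a' b' :=
  HasCoresolution.mono (inf_le_inf_left _ (homologyIn_mono h h'))

/-- Requiring `T` to lie in the interval costs nothing, since intervals may be enlarged. -/
lemma coAuslander_iff {X : DerivedCategory.Bounded A} :
    coAuslander T X ↔ ∃ a b, coAus T a b X := by
  constructor
  · rintro ⟨a, b, -, h⟩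
    exact ⟨a, b, coAuslanderIn_iff.1 h⟩
  · rintro ⟨a, b, h⟩
    obtain ⟨a', b', h'⟩ := exists_homologyIn T
    exact ⟨min a a', max b b', homologyIn_mono (by simp) (by simp) _ h',
      coAuslanderIn_iff.2 (coAus_mono (by simp) (by simp) _ h)⟩

instance (a b : ℤ) : (coAus T a b).IsTriangulatedClosed₂ :=
  HasCoresolution.closed₂ (fun _ _ => addClosure_biprod)
    fun _ _ hZ hN => hZ.1.homsZero_addClosure hN one_pos

instance (a b : ℤ) : (coAus T a b).IsStableUnderRetracts :=
  HasCoresolution.retracts (fun _ _ => addClosure_biprod)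
    fun _ _ hZ hN => hZ.1.homsZero_addClosure hN one_pos

lemma coAus_of_isZero (a b : ℤ) {X : DerivedCategory.Bounded A} (h : IsZero X) :
    coAus T a b X :=
  HasCoresolution.coind (C := fun X => IsZero X)
    (fun _ hX => ⟨leftPerpPos_of_isZero T hX, homologyIn_of_isZero a b hX⟩)
    (fun X hX => ⟨X, X, addClosure_of_isZero T hX, hX, 𝟙 _, 0, 0,
      isomorphic_distinguished _ (contractible_distinguished X) _
        (Triangle.isoMk _ _ (Iso.refl _) (Iso.refl _) (hX.iso (isZero_zero _))
          (hX.eq_of_src _ _) (hX.eq_of_src _ _) (hX.eq_of_src _ _))⟩) _ h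

/-- Prepend `X[-1] → 0 → X` to a coresolution of `X`. The interval must contain both that of `X` and
its translate by one, hence `b + 1`. -/
lemma coAus.shift_neg_one {a b : ℤ} {X : DerivedCategory.Bounded A} (h : coAus T a b X) :
    coAus T a (b + 1) (X⟦(-1 : ℤ)⟧) := by
  refine HasCoresolution.coind
    (C := fun Y => coAus T a (b + 1) Y ∨ ∃ X, coAus T a b X ∧ Nonempty (Y ≅ X⟦(-1 : ℤ)⟧))
    ?_ ?_ _ (Or.inr ⟨X, h, ⟨Iso.refl _⟩⟩)
  · rintro Y (hY | ⟨X, hX, ⟨e⟩⟩)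
    · exact hY.prop
    · exact ObjectProperty.prop_of_iso _ e.symm ⟨hX.prop.1.shift (by simp),
        homologyIn_mono (by simp) (by simp) _
          (hX.prop.2.shift (-1) (a' := a + 1) (b' := b + 1) (by simp) (by simp))⟩
  · rintro Y (hY | ⟨X, hX, ⟨e⟩⟩)
    · obtain ⟨N, X', hN, hX', h⟩ := hY.step
      exact ⟨N, X', hN, Or.inl hX', h⟩
    · refine ⟨0, X, addClosure_of_isZero T (isZero_zero _),
        Or.inl (coAus_mono (by simp) (by simp) _ hX), ?_⟩
      exact IsTri.of_iso ⟨_, _, _, inv_rot_of_distTriang _ (contractible_distinguished₁ X)⟩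
        e.symm (Iso.refl _) (Iso.refl _)

lemma coAus.shift_neg {a b : ℤ} {X : DerivedCategory.Bounded A} (h : coAus T a b X) {n : ℤ}
    (hn : n ≤ 0) : ∃ b', coAus T a b' (X⟦n⟧) := by
  obtain ⟨n, rfl⟩ : ∃ m : ℕ, n = -m := ⟨n.natAbs, by omega⟩
  induction n with
  | zero => exact ⟨b, ObjectProperty.prop_of_iso _
      ((shiftFunctorZero' _ _ (by simp)).symm.app X) h⟩
  | succ n ih =>
    obtain ⟨b', h'⟩ := ih (by simp)
    exact ⟨b' + 1, ObjectProperty.prop_of_iso _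
      ((shiftFunctorAdd' _ (-(n : ℤ)) (-1) _ (by push_cast; omega)).symm.app X) h'.shift_neg_one⟩

variable (T) in
/-- `⟨𝒳_T^♭⟩₊`. -/
abbrev shiftedCoAus : ObjectProperty (DerivedCategory.Bounded A) := nonnegShifts (coAuslander T)

lemma shiftedCoAus_iff {X : DerivedCategory.Bounded A} :
    shiftedCoAus T X ↔ ∃ n : ℤ, 0 ≤ n ∧ ∃ a b, coAus T a b (X⟦-n⟧) := by
  constructor
  · rintro ⟨C, n, hC, hn, ⟨e⟩⟩
    obtain ⟨a, b, h⟩ := coAuslander_iff.1 hC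
    exact ⟨n, hn, a, b, ObjectProperty.prop_of_iso _
      ((shiftEquiv _ n).unitIso.app C ≪≫ (shiftFunctor _ (-n)).mapIso e.symm) h⟩
  · rintro ⟨n, hn, h⟩
    exact ⟨X⟦-n⟧, n, coAuslander_iff.2 h, hn, ⟨(shiftEquiv _ n).counitIso.symm.app X⟩⟩

lemma coAus_shift_of_le {X : DerivedCategory.Bounded A} {n m : ℤ}
    (h : ∃ a b, coAus T a b (X⟦n⟧)) (hm : m ≤ n) : ∃ a b, coAus T a b (X⟦m⟧) := by
  obtain ⟨a, b, h⟩ := h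
  obtain ⟨b', h'⟩ := h.shift_neg (n := m - n) (by omega)
  exact ⟨a, b', ObjectProperty.prop_of_iso _
    ((shiftFunctorAdd' _ n (m - n) m (by omega)).symm.app X) h'⟩

instance : (shiftedCoAus T).IsStableUnderRetracts where
  of_retract r h := by
    rw [shiftedCoAus_iff] at h ⊢
    obtain ⟨n, hn, a, b, h⟩ := h
    exact ⟨n, hn, a, b, ObjectProperty.prop_of_retract _ (r.map (shiftFunctor _ (-n))) h⟩

/-- The class `⟨𝒳_T^♭⟩₊` is a triangulated subcategory. -/
instance : (shiftedCoAus T).IsTriangulated where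
  exists_zero := ⟨0, isZero_zero _, shiftedCoAus_iff.2
    ⟨0, le_rfl, 0, 0, coAus_of_isZero _ _ (Functor.map_isZero _ (isZero_zero _))⟩⟩
  isStableUnderShiftBy k :=
    { le_shift := by
        intro X hX
        change shiftedCoAus T (X⟦k⟧)
        rw [shiftedCoAus_iff] at hX ⊢
        obtain ⟨n, hn, h⟩ := hX
        -- The new exponent `m` must be nonnegative and satisfy `k - m ≤ -n`.
        obtain ⟨a, b, h⟩ := coAus_shift_of_le h (m := k - max 0 (n + k)) (by omega)
        exact ⟨max 0 (n + k), by simp, a, b, ObjectProperty.prop_of_iso _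
          ((shiftFunctorAdd' _ k _ _ (by omega)).app X) h⟩ }
  toIsTriangulatedClosed₂ := .mk' fun S hS h₁ h₃ => by
    rw [shiftedCoAus_iff] at h₁ h₃ ⊢
    obtain ⟨n, hn, h₁⟩ := h₁
    obtain ⟨m, hm, h₃⟩ := h₃
    obtain ⟨a, b, h₁⟩ := coAus_shift_of_le h₁ (m := - max n m) (by omega)
    obtain ⟨a', b', h₃⟩ := coAus_shift_of_le h₃ (m := - max n m) (by omega)
    exact ⟨max n m, by omega, min a a', max b b',
      (IsTri.shift ⟨_, _, _, hS⟩ _).prop₂ (coAus T (min a a') (max b b'))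
        (coAus_mono (by simp) (by simp) _ h₁) (coAus_mono (by simp) (by simp) _ h₃)⟩

end Derived

end WakamatsuSilting

namespace WakamatsuSilting

/-! ### Dévissage and objects of finite projective dimension. -/

section Derived

variable {A : Type u} [Category.{v} A] [Abelian A] [HasDerivedCategory.{w} A]

open DerivedCategory Triangulated ZeroObject

/-- The functor sending an object of `A` to the complex concentrated in degree `0`. -/
noncomputable def stalk : A ⥤ DerivedCategory.Bounded A :=
  ObjectProperty.lift _ (singleFunctor A 0) fun _ => ⟨⟨0, inferInstance⟩, ⟨0, inferInstance⟩⟩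

lemma homologyIn_stalk (M : A) : homologyIn 0 0 (stalk.obj M) := by
  rw [homologyIn_iff, ObjectProperty.tStructure_isLE_iff, ObjectProperty.tStructure_isGE_iff]
  exact ⟨inferInstanceAs ((singleFunctor A 0).obj M |>.IsGE 0),
    inferInstanceAs ((singleFunctor A 0).obj M |>.IsLE 0)⟩

lemma exists_iso_stalk {X : DerivedCategory.Bounded A} (h : homologyIn 0 0 X) :
    ∃ M : A, Nonempty (X ≅ stalk.obj M) := by
  rw [homologyIn_iff, ObjectProperty.tStructure_isLE_iff, ObjectProperty.tStructure_isGE_iff] at h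
  have : X.obj.IsGE 0 := h.1
  have : X.obj.IsLE 0 := h.2
  obtain ⟨M, ⟨e⟩⟩ := exists_iso_singleFunctor_obj_of_isGE_of_isLE X.obj 0
  exact ⟨M, ⟨(ObjectProperty.fullyFaithfulι _).preimageIso (X := X) (Y := stalk.obj M) e⟩⟩

lemma exists_iso_stalk_shift {X : DerivedCategory.Bounded A} {i : ℤ} (h : homologyIn i i X) :
    ∃ M : A, Nonempty (X ≅ (stalk.obj M)⟦-i⟧) := by
  obtain ⟨M, ⟨e⟩⟩ := exists_iso_stalk (h.shift i (add_zero i) (add_zero i))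
  exact ⟨M, ⟨(shiftEquiv _ i).unitIso.app X ≪≫ (shiftFunctor _ (-i)).mapIso e⟩⟩

lemma stalk_distinguished {S : ShortComplex A} (hS : S.ShortExact) :
    ∃ δ, Triangle.mk (stalk.map S.f) (stalk.map S.g) δ ∈
      distTriang (DerivedCategory.Bounded A) := by
  let e := (DerivedCategory.Bounded.ι.commShiftIso (1 : ℤ)).app (stalk.obj S.X₁)
  let u : DerivedCategory.Bounded.ι.obj (stalk.obj S.X₃) ⟶
      DerivedCategory.Bounded.ι.obj ((stalk.obj S.X₁)⟦(1 : ℤ)⟧) := hS.singleδ ≫ e.inv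
  refine ⟨(ObjectProperty.fullyFaithfulι _).preimage u, ?_⟩
  refine isomorphic_distinguished _ hS.singleTriangle_distinguished _
    (Triangle.isoMk _ _ (Iso.refl _) (Iso.refl _) (Iso.refl _) ?_ ?_ ?_)
  · exact (Category.comp_id _).trans (Category.id_comp _).symm
  · exact (Category.comp_id _).trans (Category.id_comp _).symm
  · have h₁ : u ≫ e.hom = hS.singleδ :=
      (Category.assoc _ _ _).trans
        ((congr_arg (hS.singleδ ≫ ·) e.inv_hom_id).trans (Category.comp_id _))
    have h₂ : (𝟙 ((singleFunctor A 0).obj S.X₁))⟦(1 : ℤ)⟧' = 𝟙 _ :=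
      CategoryTheory.Functor.map_id _ _
    refine (congr_arg₂ (fun (x : (singleFunctor A 0).obj S.X₃ ⟶
      ((singleFunctor A 0).obj S.X₁)⟦(1 : ℤ)⟧) y => x ≫ y) h₁ h₂).trans ?_
    exact (Category.comp_id _).trans (Category.id_comp _).symm

lemma exists_truncation_triangle {a c : ℤ} {X : DerivedCategory.Bounded A}
    (h : homologyIn a c X) (hac : a ≤ c) :
    ∃ (X' X'' : DerivedCategory.Bounded A) (f : X' ⟶ X) (g : X ⟶ X'') (δ : X'' ⟶ X'⟦(1 : ℤ)⟧),
      homologyIn a (c - 1) X' ∧ homologyIn c c X'' ∧ Triangle.mk f g δ ∈ distTriang _ := by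
  obtain ⟨X', X'', h', h'', f, g, δ, H⟩ := (tB A).exists_triangle X (c - 1) c (by omega)
  rw [homologyIn_iff] at h
  have : (tB A).IsGE X'' c := ⟨h''⟩
  have : (tB A).IsLE X' (c - 1) := ⟨h'⟩
  refine ⟨X', X'', f, g, δ, homologyIn_iff.2 ⟨?_, ⟨h'⟩⟩, homologyIn_iff.2 ⟨⟨h''⟩, ?_⟩, H⟩
  · refine (tB A).isGE₂ _ (inv_rot_of_distTriang _ H) a ?_ h.1
    have := (tB A).isGE_shift X'' c (-1) (c + 1)
    exact (tB A).isGE_of_ge (X''⟦(-1 : ℤ)⟧) a (c + 1)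
  · refine (tB A).isLE₂ _ (rot_of_distTriang _ H) c h.2 ?_
    have := (tB A).isLE_shift X' (c - 1) 1 (c - 2)
    exact (tB A).isLE_of_le (X'⟦(1 : ℤ)⟧) (c - 2) c

lemma isZero_of_homologyIn {a b : ℤ} {X : DerivedCategory.Bounded A} (h : homologyIn a b X)
    (hab : b < a) : IsZero X := by
  rw [homologyIn_iff] at h
  have := h.1
  have := h.2
  exact (tB A).isZero X b a hab

/-- Dévissage: a class closed under extensions contains the complexes with cohomology in `[a, b]`
as soon as it contains the shifts of stalk complexes by degrees in `[a, b]`. -/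
lemma homologyIn_le {P : ObjectProperty (DerivedCategory.Bounded A)} [P.IsTriangulatedClosed₂]
    [P.IsClosedUnderIsomorphisms] (h0 : ∀ X, IsZero X → P X) {a b : ℤ}
    (h : ∀ (M : A) (i : ℤ), a ≤ i → i ≤ b → P ((stalk.obj M)⟦-i⟧)) : homologyIn a b ≤ P := by
  by_cases hab : b < a
  · exact fun X hX => h0 X (isZero_of_homologyIn hX hab)
  · obtain ⟨n, rfl⟩ : ∃ n : ℕ, b = a + n - 1 := ⟨(b - a + 1).natAbs, by omega⟩
    clear hab
    induction n with
    | zero => exact fun X hX => h0 X (isZero_of_homologyIn hX (by simp))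
    | succ n ih =>
      intro X hX
      obtain ⟨X', X'', f, g, δ, hX', hX'', H⟩ := exists_truncation_triangle hX (by push_cast; omega)
      refine IsTri.prop₂ P ⟨_, _, _, H⟩ (ih (fun M i h₁ h₂ => h M i h₁ (by omega)) _
        (homologyIn_mono le_rfl (by push_cast; omega) _ hX')) ?_
      obtain ⟨M, ⟨e⟩⟩ := exists_iso_stalk_shift hX''
      exact P.prop_of_iso e.symm (h _ _ (by push_cast; omega) le_rfl)

/-- `Y` is represented by a complex living in degrees at most `b < 0`, which receives no nonzero
derived map from a projective in degree `0`. -/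
lemma homsZero_of_projective (Q : A) [Projective Q] {a b : ℤ} {Y : DerivedCategory.Bounded A}
    (h : homologyIn a b Y) (hb : b < 0) : HomsZero (stalk.obj Q) Y := fun f => by
  rw [homologyIn_iff, ObjectProperty.tStructure_isLE_iff] at h
  have : Y.obj.IsLE b := h.2
  obtain ⟨L, _, ⟨e⟩⟩ := exists_iso_Q_obj_of_isLE Y.obj b
  have key : HomsZero ((singleFunctor A 0).obj Q) Y.obj :=
    HomsZero.of_iso (fun φ => from_singleFunctor_obj_eq_zero_of_projective φ b hb)
      ((singleFunctorIsoCompQ A 0).symm.app Q) e.symm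
  exact DerivedCategory.Bounded.ι.map_injective (key _)

section

variable (P : ObjectProperty (DerivedCategory.Bounded A)) [P.IsTriangulated]
  [P.IsClosedUnderIsomorphisms]
  (hP : ∀ M : A, ∃ Q : A, Projective Q ∧ P (stalk.obj Q) ∧ ∃ π : Q ⟶ M, Epi π)

include hP

/-- One step of a projective resolution: a projective cover-like epimorphism `Q → H⁰(X)` lifts to
`X`, and the cone of the lift has no cohomology in degree `0`. -/
lemma homologyIn_zero_le_extensionProduct {a : ℤ} (ha : a ≤ 0) :
    homologyIn a 0 ≤ P.extensionProduct (homologyIn (min a (-1)) (-1)) := by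
  intro X hX
  obtain ⟨X', X'', f, g, δ, hX', hX'', H⟩ := exists_truncation_triangle hX ha
  obtain ⟨M, ⟨e⟩⟩ := exists_iso_stalk hX''
  obtain ⟨Q, hQ, hPQ, π, hπ⟩ := hP M
  obtain ⟨ε, hε⟩ := stalk_distinguished
    (ShortComplex.ShortExact.mk' (S := ShortComplex.mk (kernel.ι π) π (kernel.condition π))
      (ShortComplex.exact_kernel π) inferInstance hπ)
  have hX1 := hX'.shift 1 (a' := a - 1) (b' := -2) (by omega) (by omega)
  obtain ⟨l, hl⟩ : ∃ l : stalk.obj Q ⟶ X, stalk.map π ≫ e.inv = l ≫ g :=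
    Triangle.coyoneda_exact₂ _ (rot_of_distTriang _ H) _
      (homsZero_of_projective Q hX1 (by omega) _)
  obtain ⟨V, v, v', hV⟩ := distinguished_cocone_triangle l
  have hσ : Triangle.mk (stalk.map π ≫ e.inv) (e.hom ≫ ε) (-(stalk.map (kernel.ι π))⟦(1 : ℤ)⟧') ∈
      distTriang (DerivedCategory.Bounded A) := by
    refine isomorphic_distinguished _ (rot_of_distTriang _ hε) _
      (Triangle.isoMk _ _ (Iso.refl _) e (Iso.refl _) ?_ ?_ ?_)
    · change (stalk.map π ≫ e.inv) ≫ e.hom = 𝟙 _ ≫ stalk.map π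
      simp
    · change (e.hom ≫ ε) ≫ 𝟙 _ = e.hom ≫ ε
      simp
    · change (-(stalk.map (kernel.ι π))⟦(1 : ℤ)⟧') ≫ (𝟙 (stalk.obj Q))⟦(1 : ℤ)⟧' =
        𝟙 _ ≫ (-(stalk.map (kernel.ι π))⟦(1 : ℤ)⟧')
      simp
  -- The octahedron makes `V` an extension of `(ker π)[1]` by the truncation `X'`, both living in
  -- negative degrees.
  have o := inv_rot_of_distTriang _
    (someOctahedron hl.symm hV (rot_of_distTriang _ H) hσ).mem
  refine ⟨_, V, l, v, v', hV, hPQ, IsTri.prop₂ _ ⟨_, _, _, o⟩ ?_ ?_⟩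
  · exact homologyIn_mono (by omega) (by omega) _
      (hX1.shift (-1) (a' := a) (b' := -1) (by omega) (by omega))
  · exact homologyIn_mono (by simp) (by omega) _
      ((homologyIn_stalk _).shift 1 (a' := -1) (b' := -1) (by omega) (by omega))

lemma homologyIn_le_extensionProduct {a c : ℤ} (hac : a ≤ c) :
    homologyIn a c ≤ P.extensionProduct (homologyIn (min a (c - 1)) (c - 1)) := by
  intro X hX
  obtain ⟨W, V, f, g, h, H, hW, hV⟩ := homologyIn_zero_le_extensionProduct P hP
    (a := a - c) (by omega) _ (hX.shift c (by omega) (by omega))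
  refine ObjectProperty.prop_of_iso _ ((shiftEquiv _ c).unitIso.symm.app X)
    ⟨_, _, _, _, _, Triangle.shift_distinguished _ H (-c), P.le_shift _ _ hW, ?_⟩
  exact hV.shift (-c) (by omega) (by omega)

lemma homologyIn_le_extensionProduct_sub {a c : ℤ} (n : ℕ) :
    homologyIn a c ≤ P.extensionProduct (homologyIn (min a (c - n)) (c - n)) := by
  induction n with
  | zero =>
    refine (homologyIn_mono (by simp) (by simp)).trans
      (ObjectProperty.le_extensionProduct_right P)
  | succ n ih =>
    calc homologyIn a c ≤ _ := ih
      _ ≤ P.extensionProduct (P.extensionProduct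
          (homologyIn (min (min a (c - n)) (c - n - 1)) (c - n - 1))) :=
        ObjectProperty.monotone_extensionProduct_right _
          (homologyIn_le_extensionProduct P hP (by omega))
      _ = (P.extensionProduct P).extensionProduct _ :=
        (ObjectProperty.extensionProduct_assoc _ _ _).symm
      _ ≤ P.extensionProduct (homologyIn (min (min a (c - n)) (c - n - 1)) (c - n - 1)) :=
        ObjectProperty.monotone_extensionProduct_left _
          (ObjectProperty.extensionProduct_le_of_isTriangulatedClosed₂ le_rfl le_rfl)
      _ ≤ _ := ObjectProperty.monotone_extensionProduct_right _
          (homologyIn_mono (by push_cast; omega) (by push_cast; omega))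

/-- A thick subcategory containing enough projectives contains the complexes of finite projective
dimension. -/
lemma prop_of_homsZero [P.IsStableUnderRetracts] {X : DerivedCategory.Bounded A} {i₀ : ℤ}
    (h : ∀ (M : A) (i : ℤ), i₀ ≤ i → HomsZero X ((stalk.obj M)⟦i⟧)) : P X := by
  obtain ⟨a, c, hX⟩ := exists_homologyIn X
  -- The first summand makes `V` a shifted stalk; the second puts it in a degree at most `-i₀`, so
  -- that `X → V` vanishes and `X` splits off `W`.
  obtain ⟨W, V, f, g, δ, H, hW, hV⟩ := homologyIn_le_extensionProduct_sub P hP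
    ((c - a).natAbs + (c + i₀).natAbs) _ hX
  rw [min_eq_right (by omega)] at hV
  obtain ⟨M, ⟨e⟩⟩ := exists_iso_stalk_shift hV
  have hg : g = 0 := (h M _ (by omega)).of_iso (Iso.refl X) e.symm g
  obtain ⟨s, hs⟩ : ∃ s : X ⟶ W, 𝟙 X = s ≫ f :=
    Triangle.coyoneda_exact₂ _ H (𝟙 X) (show 𝟙 X ≫ g = 0 by simp [hg])
  exact P.prop_of_retract ⟨s, f, hs.symm⟩ hW

end

end Derived

end WakamatsuSilting

namespace WakamatsuSilting

/-! ### Finitely generated modules over an artinian ring. -/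

section Modules

instance {C : Type u} [Category.{v} C] {D : Type w} [Category.{w'} D] (F : C ⥤ D)
    (P : ObjectProperty D) [P.IsStableUnderRetracts] : (P.inverseImage F).IsStableUnderRetracts where
  of_retract r h := P.prop_of_retract (r.map F) h

instance {A : Type u} [Category.{v} A] [Abelian A] [HasDerivedCategory.{w} A] :
    (stalk (A := A)).Additive where
  map_add := (ObjectProperty.ι _).map_injective (DerivedCategory.singleFunctor A 0).map_add

variable {R : Type u} [Ring R]

lemma fgModuleCat_shortExact [IsNoetherianRing R] {M : Type u} [AddCommGroup M] [Module R M]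
    (N : Submodule R M) [Module.Finite R M] [Module.Finite R N] :
    ∃ S : ShortComplex (FGModuleCat.{u} R), S.ShortExact ∧ S.X₁ = FGModuleCat.of R N ∧
      S.X₂ = FGModuleCat.of R M ∧ S.X₃ = FGModuleCat.of R (M ⧸ N) := by
  let f : FGModuleCat.of R N ⟶ FGModuleCat.of R M := FGModuleCat.ofHom N.subtype
  let g : FGModuleCat.of R M ⟶ FGModuleCat.of R (M ⧸ N) := FGModuleCat.ofHom N.mkQ
  have hfg : f ≫ g = 0 := by
    ext x
    exact (Submodule.Quotient.mk_eq_zero N).2 x.2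
  refine ⟨ShortComplex.mk f g hfg, ?_, rfl, rfl, rfl⟩
  refine ShortExact.reflects_shortExact_of_faithful
    (forget₂ (FGModuleCat.{u} R) (ModuleCat.{u} R)) ?_
  refine ModuleCat.shortComplex_shortExact _ ?_ N.injective_subtype N.mkQ_surjective
  exact LinearMap.exact_subtype_mkQ N

lemma fgModuleCat_projective {M : Type u} [AddCommGroup M] [Module R M] [IsNoetherianRing R]
    [Module.Finite R M] [Module.Projective R M] : Projective (FGModuleCat.of R M) where
  factors {E X} f e he := by
    have he' : Function.Surjective e.hom.hom :=
      (ModuleCat.epi_iff_surjective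
        ((forget₂ (FGModuleCat.{u} R) (ModuleCat.{u} R)).map e)).1 inferInstance
    obtain ⟨h, hh⟩ := Module.projective_lifting_property e.hom.hom f.hom.hom he'
    exact ⟨FGModuleCat.ofHom h, by ext x; exact LinearMap.congr_fun hh x⟩

/-- A simple module is `R/I` with `I` maximal, hence a quotient of `R/J`, and quotients of a
semisimple module split. -/
lemma exists_retract_of_isSimpleModule [IsArtinianRing R] {L : Type u} [AddCommGroup L]
    [Module R L] [IsSimpleModule R L] :
    ∃ (i : L →ₗ[R] R ⧸ Ring.jacobson R) (r : R ⧸ Ring.jacobson R →ₗ[R] L),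
      r ∘ₗ i = LinearMap.id := by
  have : IsSemisimpleModule R (R ⧸ Ring.jacobson R) :=
    (IsArtinian.isSemisimpleModule_iff_jacobson R _).2 (Module.jacobson_quotient_jacobson R R)
  obtain ⟨I, hI, ⟨e⟩⟩ := isSimpleModule_iff_quot_maximal.1 ‹IsSimpleModule R L›
  let r : R ⧸ Ring.jacobson R →ₗ[R] L :=
    e.symm.toLinearMap ∘ₗ Submodule.factor (Ring.jacobson_le_of_isMaximal I)
  obtain ⟨i, hi⟩ := IsSemisimpleModule.lifting_property r
    (e.symm.surjective.comp (Submodule.factor_surjective _)) LinearMap.id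
  exact ⟨i, r, hi⟩

variable (R) in
/-- The largest semisimple quotient of an artinian ring, as a finitely generated module. -/
abbrev semisimpleTop : FGModuleCat.{u} R := FGModuleCat.of R (R ⧸ Ring.jacobson R)

lemma prop_fgModuleCat_of_semisimpleTop [IsArtinianRing R] (P : ObjectProperty (FGModuleCat.{u} R))
    [P.IsStableUnderRetracts]
    (hext : ∀ S : ShortComplex (FGModuleCat.{u} R), S.ShortExact → P S.X₁ → P S.X₃ → P S.X₂)
    (hP : P (semisimpleTop R)) (M : FGModuleCat.{u} R) : P M := by
  have key : ∀ (M : Type u) [AddCommGroup M] [Module R M] (_ : IsFiniteLength R M)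
      [Module.Finite R M], P (FGModuleCat.of R M) := by
    intro M _ _ hM
    induction hM with
    | of_subsingleton =>
      intro _
      -- The zero module is a retract of anything.
      exact P.prop_of_retract ⟨0, 0, by ext x; exact Subsingleton.elim _ _⟩ hP
    | @of_simple_quotient M _ _ N _ _ ih =>
      intro _
      obtain ⟨S, hS, h₁, h₂, h₃⟩ := fgModuleCat_shortExact N
      rw [← h₂]
      refine hext S hS (h₁ ▸ ih) ?_
      rw [h₃]
      obtain ⟨i, r, hir⟩ := exists_retract_of_isSimpleModule (R := R) (L := M ⧸ N)
      exact P.prop_of_retract (Y := semisimpleTop R) ⟨FGModuleCat.ofHom i, FGModuleCat.ofHom r,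
        by ext x; exact LinearMap.congr_fun hir (N.mkQ x)⟩ hP
  exact key M (isFiniteLength_iff_isNoetherian_isArtinian.2 ⟨inferInstance, inferInstance⟩)

section

variable [IsNoetherianRing R] [HasDerivedCategory.{w} (FGModuleCat.{u} R)]

lemma prop_stalk_shift_of_semisimpleTop [IsArtinianRing R]
    (P : ObjectProperty (DerivedCategory.Bounded (FGModuleCat.{u} R)))
    [P.IsStableUnderRetracts] [P.IsTriangulatedClosed₂] {i : ℤ}
    (hP : P ((stalk.obj (semisimpleTop R))⟦i⟧)) (M : FGModuleCat.{u} R) :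
    P ((stalk.obj M)⟦i⟧) := by
  refine prop_fgModuleCat_of_semisimpleTop
    (P.inverseImage (stalk ⋙ shiftFunctor _ i)) (fun S hS h₁ h₃ => ?_) hP M
  obtain ⟨δ, hδ⟩ := stalk_distinguished hS
  exact (IsTri.shift ⟨_, _, _, hδ⟩ i).prop₂ P h₁ h₃

lemma prop_stalk_pi (P : ObjectProperty (DerivedCategory.Bounded (FGModuleCat.{u} R)))
    [P.IsTriangulated] [P.IsStableUnderRetracts]
    (hP : P (stalk.obj (FGModuleCat.of R R))) (n : ℕ) :
    P (stalk.obj (FGModuleCat.of R (Fin n → R))) := by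
  refine P.prop_of_retract (Y := ⨁ fun _ : Fin n => stalk.obj (FGModuleCat.of R R)) ⟨
    biproduct.lift fun j => stalk.map (FGModuleCat.ofHom (LinearMap.proj j)),
    biproduct.desc fun j => stalk.map (FGModuleCat.ofHom (LinearMap.single R (fun _ => R) j)), ?_⟩
    (P.prop_of_iso (biproduct.isoProduct _).symm (P.prop_pi _ fun _ => hP))
  rw [biproduct.lift_desc]
  simp only [← Functor.map_comp, ← Functor.map_sum]
  rw [← CategoryTheory.Functor.map_id]
  congr 1
  refine FGModuleCat.hom_ext ((map_sum (AddMonoidHom.mk' (fun f : FGModuleCat.of R (Fin n → R) ⟶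
    FGModuleCat.of R (Fin n → R) => f.hom.hom) fun _ _ => rfl) _ _).trans ?_)
  change ∑ j, LinearMap.single R (fun _ => R) j ∘ₗ LinearMap.proj j = LinearMap.id
  refine LinearMap.ext fun x => ?_
  simp only [LinearMap.sum_apply, LinearMap.comp_apply, LinearMap.proj_apply, LinearMap.id_apply]
  exact Finset.univ_sum_single x

lemma exists_projective_epi (P : ObjectProperty (DerivedCategory.Bounded (FGModuleCat.{u} R)))
    [P.IsTriangulated] [P.IsStableUnderRetracts]
    (hP : P (stalk.obj (FGModuleCat.of R R))) (M : FGModuleCat.{u} R) :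
    ∃ Q : FGModuleCat.{u} R, Projective Q ∧ P (stalk.obj Q) ∧ ∃ π : Q ⟶ M, Epi π := by
  obtain ⟨n, f, hf⟩ := Module.Finite.exists_fin' R M
  refine ⟨_, fgModuleCat_projective (M := Fin n → R), prop_stalk_pi P hP n, FGModuleCat.ofHom f, ?_⟩
  have : Epi ((forget₂ (FGModuleCat.{u} R) (ModuleCat.{u} R)).map (FGModuleCat.ofHom f)) :=
    (ModuleCat.epi_iff_surjective _).2 hf
  exact (forget₂ (FGModuleCat.{u} R) (ModuleCat.{u} R)).epi_of_epi_map this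

end

end Modules

end WakamatsuSilting

namespace WakamatsuSilting

/-! ### Transport along triangle functors. -/

section Functor

universe v₁ v₂ u₁ u₂

variable {C : Type u₁} [Category.{v₁} C] [Preadditive C] [HasZeroObject C] [HasShift C ℤ]
  [∀ n : ℤ, (shiftFunctor C n).Additive] [Pretriangulated C]
  {D : Type u₂} [Category.{v₂} D] [Preadditive D] [HasZeroObject D] [HasShift D ℤ]
  [∀ n : ℤ, (shiftFunctor D n).Additive] [Pretriangulated D]
  (F : C ⥤ D) [F.CommShift ℤ] [F.IsTriangulated]

lemma IsTri.map {X Y Z : C} (H : IsTri X Y Z) : IsTri (F.obj X) (F.obj Y) (F.obj Z) := by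
  obtain ⟨f, g, h, H⟩ := H
  exact ⟨_, _, _, F.map_distinguished _ H⟩

instance (P : ObjectProperty D) [P.IsTriangulatedClosed₂] [P.IsClosedUnderIsomorphisms] :
    (P.inverseImage F).IsTriangulatedClosed₂ :=
  .mk' fun _ hT h₁ h₃ => (IsTri.map F ⟨_, _, _, hT⟩).prop₂ P h₁ h₃

lemma addClosure.map {M N : C} (h : addClosure M N) {M' : D} (e : F.obj M ≅ M') :
    addClosure M' (F.obj N) := by
  obtain ⟨n, ⟨r⟩⟩ := addClosure_iff.1 h
  exact addClosure_iff.2 ⟨n, ⟨(r.map F).trans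
    (.ofIso (F.mapBiproduct _ ≪≫ biproduct.mapIso fun _ => e))⟩⟩

lemma HomsZero.map_shift [F.Full] {X M : C} {k : ℤ} (h : HomsZero X (M⟦k⟧)) {X' M' : D}
    (e : F.obj X ≅ X') (e' : F.obj M ≅ M') : HomsZero X' (M'⟦k⟧) := by
  refine HomsZero.of_iso (X := F.obj X) (Y := F.obj (M⟦k⟧)) (fun f => ?_) e
    ((F.commShiftIso k).app M ≪≫ (shiftFunctor D k).mapIso e')
  obtain ⟨g, rfl⟩ := F.map_surjective f
  rw [h g, F.map_zero]

lemma HasCoresolution.map {A Q : ObjectProperty C} {A' Q' : ObjectProperty D}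
    (hA : A ≤ A'.inverseImage F) (hQ : Q ≤ Q'.inverseImage F) {X : C}
    (h : HasCoresolution A Q X) : HasCoresolution A' Q' (F.obj X) := by
  obtain ⟨Y, N, ⟨e⟩, hN, hY, hT⟩ := h
  exact ⟨fun i => F.obj (Y i), fun i => F.obj (N i), ⟨F.mapIso e⟩, fun i => hA _ (hN i),
    fun i => hQ _ (hY i), fun i => (hT i).map F⟩

end Functor

/-! ### Derived equivalences of artin algebras. -/

section Algebra

instance (R : Type u) [Ring R] [IsArtinAlgebra R] : IsArtinianRing R := by
  obtain ⟨k, _, _, _, _⟩ := IsArtinAlgebra.exists_base (R := R)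
  have : IsArtinian k R := inferInstance
  exact isArtinian_of_tower k this

variable {R : Type u} [Ring R] [IsArtinAlgebra R] {S : Type v} [Ring S] [IsArtinAlgebra S]
  [HasDerivedCategory.{w} (FGModuleCat.{u} R)] [HasDerivedCategory.{w'} (FGModuleCat.{v} S)]
  (F : Db R ⥤ Db S) [F.CommShift ℤ] [F.IsTriangulated]

/-- A triangle functor is bounded. -/
lemma exists_homologyIn_le_inverseImage (a b : ℤ) :
    ∃ a' b', homologyIn a b ≤ (homologyIn a' b').inverseImage F := by
  obtain ⟨c, d, h⟩ := exists_homologyIn (F.obj (stalk.obj (semisimpleTop R)))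
  refine ⟨c + a, d + b, homologyIn_le (P := (homologyIn (c + a) (d + b)).inverseImage F)
    (fun X hX => homologyIn_of_isZero _ _ (F.map_isZero hX))
    fun M i hi hi' => prop_stalk_shift_of_semisimpleTop
      ((homologyIn (c + a) (d + b)).inverseImage F) ?_ M⟩
  refine ObjectProperty.prop_of_iso (homologyIn (c + a) (d + b)) ((F.commShiftIso (-i)).symm.app _) ?_
  exact homologyIn_mono (by omega) (by omega) _
    (h.shift (-i) (a' := c + i) (b' := d + i) (by omega) (by omega))

lemma coAus.map [F.Full] {T X : Db R} {T' : Db S} (e : F.obj T ≅ T') {a b : ℤ}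
    (h : coAus T a b X) : ∃ a' b', coAus T' a' b' (F.obj X) := by
  obtain ⟨a', b', hF⟩ := exists_homologyIn_le_inverseImage F a b
  refine ⟨a', b', HasCoresolution.map F (fun N hN => hN.map F e) (fun Y hY => ?_) h⟩
  exact ⟨fun k hk => HomsZero.map_shift F (hY.1 k hk) (Iso.refl _) e, hF _ hY.2⟩

lemma shiftedCoAus_map [F.Full] {T X : Db R} {T' : Db S} (e : F.obj T ≅ T')
    (h : shiftedCoAus T X) : shiftedCoAus T' (F.obj X) := by
  obtain ⟨C, n, hC, hn, ⟨e'⟩⟩ := h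
  obtain ⟨a, b, hC⟩ := coAuslander_iff.1 hC
  exact ⟨F.obj C, n, coAuslander_iff.2 (coAus.map F e hC), hn,
    ⟨F.mapIso e' ≪≫ (F.commShiftIso n).app C⟩⟩

/-- An object corresponding to a projective module under a triangle equivalence has finite
projective dimension. -/
lemma exists_homsZero_of_iso_stalk [F.Full] [F.Faithful] {X : Db R} {Q : FGModuleCat.{v} S}
    [Projective Q] (e : F.obj X ≅ stalk.obj Q) :
    ∃ i₀ : ℤ, ∀ (M : FGModuleCat.{u} R) (i : ℤ), i₀ ≤ i → HomsZero X ((stalk.obj M)⟦i⟧) := by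
  obtain ⟨c, d, h⟩ := exists_homologyIn (F.obj (stalk.obj (semisimpleTop R)))
  -- For `i > d`, the cohomology of `F(R/J)[i]` lies in negative degrees, where a projective stalk
  -- sees nothing.
  refine ⟨d + 1, fun M i hi => ?_⟩
  let P : ObjectProperty (Db R) := fun Y => HomsZero X Y
  have : P.IsStableUnderRetracts := ⟨fun r h => h.of_retract (.refl _) r⟩
  have : P.IsTriangulatedClosed₂ :=
    .mk' fun T hT h₁ h₃ => HomsZero.of_isTri_target ⟨_, _, _, hT⟩ h₁ h₃
  refine prop_stalk_shift_of_semisimpleTop P (fun f => F.map_injective ?_) M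
  rw [F.map_zero]
  exact HomsZero.of_iso (homsZero_of_projective Q (h.shift i (a' := c - i) (b' := d - i)
    (by omega) (by omega)) (by omega)) e.symm ((F.commShiftIso i).symm.app _) _

/-- Taking `T'` only up to isomorphism lets the inverse equivalence be used with `T' = T`. -/
lemma IsWakamatsuSilting.map [F.IsEquivalence] {T : Db R} {T' : Db S} (e : F.obj T ≅ T')
    (h : IsWakamatsuSilting T) : IsWakamatsuSilting T' := by
  refine ⟨fun k hk => HomsZero.map_shift F (h.1 k hk) e e, ?_⟩
  have hS : Projective (FGModuleCat.of S S) := fgModuleCat_projective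
  let e' := F.objObjPreimageIso (stalk.obj (FGModuleCat.of S S))
  obtain ⟨i₀, hi₀⟩ := exists_homsZero_of_iso_stalk F e'
  let P := (shiftedCoAus T').inverseImage F
  have hP : P (stalk.obj (FGModuleCat.of R R)) := shiftedCoAus_map F e h.2
  exact ObjectProperty.prop_of_iso _ e' (prop_of_homsZero P (exists_projective_epi P hP) hi₀)

lemma isWakamatsuSilting_iff_of_equivalence (E : Db R ≌ Db S) (hE : E.functor = F) (T : Db R) :
    IsWakamatsuSilting T ↔ IsWakamatsuSilting (F.obj T) := by
  subst hE
  refine ⟨fun h => h.map E.functor (Iso.refl _), fun h => ?_⟩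
  let := E.commShiftInverse ℤ
  have := E.commShift_of_functor ℤ
  have : E.IsTriangulated := .mk' E inferInstance
  exact h.map E.inverse (E.unitIso.symm.app T)

end Algebra

end WakamatsuSilting

theorem corollary3p3 {R : Type u} [Ring R] [IsArtinAlgebra R]
    {S : Type v} [Ring S] [IsArtinAlgebra S]
    [HasDerivedCategory.{w} (FGModuleCat.{u} R)] [HasDerivedCategory.{w'} (FGModuleCat.{v} S)]
    (F : WakamatsuSilting.Db R ⥤ WakamatsuSilting.Db S)
    [F.CommShift ℤ] [F.IsTriangulated] [F.IsEquivalence]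
    (T : WakamatsuSilting.Db R) :
    WakamatsuSilting.IsWakamatsuSilting T ↔ WakamatsuSilting.IsWakamatsuSilting (F.obj T) := by
  exact WakamatsuSilting.isWakamatsuSilting_iff_of_equivalence F F.asEquivalence rfl T
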